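/- Let $(M,\varphi,\xi,\eta,g)$ be an $n$-dimensional connected $\alpha$-cosymplectic manifold, $\alpha\in\mathbb R$: that is, $(\varphi,\xi,\eta,g)$ is an almost contact metric structure ($\varphi^2=-\mathrm{id}+\eta\otimes\xi$, $\eta(\xi)=1$, $\eta\circ\varphi=0$, $\varphi\xi=0$, $g(\varphi X,\varphi Y)=g(X,Y)-\eta(X)\eta(Y)$, $g(X,\varphi Y)=-g(\varphi X,Y)$, $\eta=g(\cdot,\xi)$), it is normal, and $d\eta=0$, $d\Phi=2\alpha\,\eta\wedge\Phi$ for $\Phi(X,Y)=g(\varphi X,Y)$. Let $\nabla$ be the Levi-Civita connection, $r$ the scalar curvature of $g$, and let $\tilde\nabla$ be the quarter-symmetric metric connection, i.e. $\tilde\nabla g=0$ and its torsion is $T(X,Y)=\eta(Y)\varphi X-\eta(X)\varphi Y$. Write $\tilde R$ for the curvature of $\tilde\nabla$, $\tilde S(Y,Z)=\operatorname{tr}(X\mapsto\tilde R(X,Y)Z)$ and $\tilde r=\operatorname{tr}_g\tilde S$ for its Ricci tensor and scalar curvature, $\tilde S^*(X,Y)=\tfrac12\operatorname{tr}\big(\varphi\circ\tilde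 R(X,\varphi Y)\big)$ and $\tilde r^*=\operatorname{tr}_g\tilde S^*$ for its $*$-Ricci tensor and $*$-scalar curvature, and $(\tilde{\mathcal L}_\xi g)(X,Y)=g(\tilde\nabla_X\xi,Y)+g(X,\tilde\nabla_Y\xi)$. Suppose that, for real constants $\Lambda,\mu$, the manifold admits a $*$-$\eta$-Einstein soliton (the case $\rho=1$, $q=-1$ of a $*$-$\eta$-Ricci-Yamabe soliton) with respect to $\tilde\nabla$, in either of the following two forms: $$\tilde{\mathcal L}_\xi g+2\tilde S^*+\big[2\Lambda+\tilde r^*\big]g+2\mu\,\eta\otimes\eta=0,$$ or $$\tilde{\mathcal L}_\xi g+2\tilde S+\big[2\Lambda+2\alpha^2(n-2)+\tilde r+\alpha^2(n-1)^2\big]g+\big[2\mu+2\alpha^2\big]\eta\otimes\eta=0.$$ If $\xi=\operatorname{grad} f$ for a smooth function $f:M\to\mathbb R$, then $f$ satisfies on $M$ the Laplace equation $$\Delta f=-n\Big[\Lambda+\alpha^2(n-2)+\frac r2+\frac{\alpha^2(n-1)^2}{2}\Big]-\mu-(\alpha^2+r),$$ where $\Delta f=\operatorname{div}(\operatorname{grad}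 f)$. -/

import Mathlib

open Bundle VectorField
open scoped Manifold ContDiff

noncomputable section

namespace StarEtaSoliton

variable {E : Type*} [NormedAddCommGroup E] [NormedSpace ℝ E] [FiniteDimensional ℝ E]
  {M : Type*} [TopologicalSpace M] [ChartedSpace E M] [IsManifold 𝓘(ℝ, E) ∞ M]

/-- The tangent space `T_x M` of a manifold (without boundary) modelled on `E`. -/
abbrev T (E : Type*) [NormedAddCommGroup E] [NormedSpace ℝ E]
    {M : Type*} [TopologicalSpace M] [ChartedSpace E M] (x : M) : Type _ :=
  TangentSpace 𝓘(ℝ, E) x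

/-- Smoothness of a (global) vector field. -/
def IsSmoothField (X : (x : M) → T E x) : Prop :=
  ContMDiff 𝓘(ℝ, E) (𝓘(ℝ, E).prod 𝓘(ℝ, E)) ∞
    (fun x ↦ (⟨x, X x⟩ : TotalSpace E (fun x : M ↦ T E x)))

/-- Smoothness of a (global) tensor field of type `(1,1)`. -/
def IsSmoothEndo (φ : (x : M) → T E x →L[ℝ] T E x) : Prop :=
  ContMDiff 𝓘(ℝ, E) (𝓘(ℝ, E).prod 𝓘(ℝ, E →L[ℝ] E)) ∞
    (fun x ↦ (⟨x, φ x⟩ : TotalSpace (E →L[ℝ] E) (fun x : M ↦ T E x →L[ℝ] T E x)))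

/-- A linear connection on `M`; `D Y x (X x)` is `(D_X Y)(x)`. -/
abbrev Connection (E : Type*) [NormedAddCommGroup E] [NormedSpace ℝ E]
    (M : Type*) [TopologicalSpace M] [ChartedSpace E M] [IsManifold 𝓘(ℝ, E) ∞ M] : Type _ :=
  CovariantDerivative 𝓘(ℝ, E) E (fun x : M ↦ T E x)

/-- The derivative `X f` of a function along a vector field. -/
def dirDeriv (X : (x : M) → T E x) (f : M → ℝ) (x : M) : ℝ :=
  mvfderiv 𝓘(ℝ, E) f x (X x)

/-- The exterior derivative of a 1-form, evaluated on vector fields: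
`dη(X,Y) = X η(Y) - Y η(X) - η([X,Y])`. -/
def extDerivOne (η : (x : M) → T E x →L[ℝ] ℝ) (X Y : (x : M) → T E x) (x : M) : ℝ :=
  dirDeriv X (fun y ↦ η y (Y y)) x - dirDeriv Y (fun y ↦ η y (X y)) x
    - η x (mlieBracket 𝓘(ℝ, E) X Y x)

/-- The exterior derivative of a 2-form, evaluated on vector fields:
`dΦ(X,Y,Z) = X Φ(Y,Z) + Y Φ(Z,X) + Z Φ(X,Y) - Φ([X,Y],Z) - Φ([Y,Z],X) - Φ([Z,X],Y)`. -/
def extDerivTwo (Φ : (x : M) → T E x → T E x → ℝ) (X Y Z : (x : M) → T E x) (x : M) : ℝ :=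
  dirDeriv X (fun y ↦ Φ y (Y y) (Z y)) x + dirDeriv Y (fun y ↦ Φ y (Z y) (X y)) x
    + dirDeriv Z (fun y ↦ Φ y (X y) (Y y)) x
    - Φ x (mlieBracket 𝓘(ℝ, E) X Y x) (Z x) - Φ x (mlieBracket 𝓘(ℝ, E) Y Z x) (X x)
    - Φ x (mlieBracket 𝓘(ℝ, E) Z X x) (Y x)

/-- The wedge product of a 1-form and a 2-form at a point (in the normalization that goes with
`extDerivOne` and `extDerivTwo`). -/
def wedgeOneTwo (η : (x : M) → T E x →L[ℝ] ℝ) (Φ : (x : M) → T E x → T E x → ℝ) (x : M)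
    (u v w : T E x) : ℝ :=
  η x u * Φ x v w + η x v * Φ x w u + η x w * Φ x u v

/-- The torsion tensor
`[φX, φY] - φ[φX, Y] - φ[X, φY] + φ²[X, Y] + dη(X, Y) ξ`
whose vanishing is normality. (With the convention in which `dη` carries a factor `1/2`, the last
term is written `2 dη(X, Y) ξ`.) -/
def normalityTensor (φ : (x : M) → T E x →L[ℝ] T E x) (ξ : (x : M) → T E x)
    (η : (x : M) → T E x →L[ℝ] ℝ) (X Y : (x : M) → T E x) (x : M) : T E x :=
  mlieBracket 𝓘(ℝ, E) (fun y ↦ φ y (X y)) (fun y ↦ φ y (Y y)) x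
    - φ x (mlieBracket 𝓘(ℝ, E) (fun y ↦ φ y (X y)) Y x)
    - φ x (mlieBracket 𝓘(ℝ, E) X (fun y ↦ φ y (Y y)) x)
    + φ x (φ x (mlieBracket 𝓘(ℝ, E) X Y x))
    + extDerivOne η X Y x • ξ x

/-- The curvature `R(X,Y)Z = D_X D_Y Z - D_Y D_X Z - D_[X,Y] Z` of a linear connection. -/
def curvatureField (D : Connection E M) (X Y Z : (x : M) → T E x) (x : M) : T E x :=
  D (fun y ↦ D Z y (Y y)) x (X x) - D (fun y ↦ D Z y (X y)) x (Y x)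
    - D Z x (mlieBracket 𝓘(ℝ, E) X Y x)

/-- The curvature tensor `R(u,v)w` at a point, computed from extensions of the three tangent vectors
to vector fields that are smooth near the point; the value does not depend on the extensions. -/
def curvature (D : Connection E M) (x : M) (u v w : T E x) : T E x :=
  curvatureField D (FiberBundle.extend E u) (FiberBundle.extend E v) (FiberBundle.extend E w) x

section Riemannian

variable [RiemannianBundle (fun x : M ↦ T E x)]

instance finiteDimensional_T (x : M) : FiniteDimensional ℝ (T E x) :=
  inferInstanceAs (FiniteDimensional ℝ E)

/-- An orthonormal basis of `T_x M`, used to take traces. -/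
def frame (x : M) : OrthonormalBasis (Fin (Module.finrank ℝ (T E x))) ℝ (T E x) :=
  stdOrthonormalBasis ℝ (T E x)

/-- The trace `∑ g(A e_i, e_i)` of an endomorphism `A` of `T_x M`. -/
def traceEndo (x : M) (A : T E x → T E x) : ℝ :=
  ∑ i, inner ℝ (A (frame x i)) (frame x i)

/-- The trace `∑ B(e_i, e_i)` of a `(0,2)`-tensor `B` at `x` with respect to the metric. -/
def traceForm (x : M) (B : T E x → T E x → ℝ) : ℝ :=
  ∑ i, B (frame x i) (frame x i)

/-- The Ricci tensor of a linear connection: `S(v,w)` is the trace of `u ↦ R(u,v)w`. -/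
def ricci (D : Connection E M) (x : M) (v w : T E x) : ℝ :=
  traceEndo x (fun u ↦ curvature D x u v w)

/-- The scalar curvature of a linear connection (the metric trace of its Ricci tensor). -/
def scalarCurv (D : Connection E M) (x : M) : ℝ :=
  traceForm x (ricci D x)

/-- The `∗`-Ricci tensor of a linear connection: `S*(u,v) = ½ trace (φ ∘ R(u, φ v))`. -/
def starRicci (D : Connection E M) (φ : (x : M) → T E x →L[ℝ] T E x) (x : M) (u v : T E x) : ℝ :=
  (1 / 2) * traceEndo x (fun w ↦ φ x (curvature D x u (φ x v) w))

/-- The `∗`-scalar curvature `r* = Tr S*` of a linear connection. -/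
def starScalarCurv (D : Connection E M) (φ : (x : M) → T E x →L[ℝ] T E x) (x : M) : ℝ :=
  traceForm x (starRicci D φ x)

/-- The Lie derivative of the metric along `V` with respect to a connection `D`:
`g(D_u V, v) + g(u, D_v V)`. For the Levi-Civita connection it is the usual Lie derivative. -/
def lieMetric (D : Connection E M) (V : (x : M) → T E x) (x : M) (u v : T E x) : ℝ :=
  inner ℝ (D V x u) v + inner ℝ u (D V x v)

/-- The gradient of a function: `g(grad f, v) = df(v)`. -/
def grad (f : M → ℝ) (x : M) : T E x :=
  haveI : CompleteSpace (T E x) := FiniteDimensional.complete ℝ (T E x)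
  (InnerProductSpace.toDual ℝ (T E x)).symm (mvfderiv 𝓘(ℝ, E) f x)

/-- The divergence of a vector field with respect to a connection: the trace of `u ↦ D_u V`. -/
def divergence (D : Connection E M) (V : (x : M) → T E x) (x : M) : ℝ :=
  traceEndo x (fun u ↦ D V x u)

/-- The Laplacian `Δ f = div (grad f)`. -/
def laplacian (D : Connection E M) (f : M → ℝ) (x : M) : ℝ :=
  divergence D (fun y ↦ grad f y) x

/-- The 2-form `Φ(u,v) = g(φ u, v)`. -/
def fundamentalForm (φ : (x : M) → T E x →L[ℝ] T E x) (x : M) (u v : T E x) : ℝ :=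
  inner ℝ (φ x u) v

/-- `(φ, ξ, η, g)` is an almost contact metric structure. (Smoothness of `η = g(·, ξ)` follows
from that of `ξ` and `g`.) -/
structure IsAlmostContactMetric (φ : (x : M) → T E x →L[ℝ] T E x) (ξ : (x : M) → T E x)
    (η : (x : M) → T E x →L[ℝ] ℝ) : Prop where
  smooth_phi : IsSmoothEndo φ
  smooth_xi : IsSmoothField ξ
  phi_sq : ∀ x u, φ x (φ x u) = -u + η x u • ξ x
  eta_xi : ∀ x, η x (ξ x) = 1
  eta_phi : ∀ x u, η x (φ x u) = 0
  phi_xi : ∀ x, φ x (ξ x) = 0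
  compatible : ∀ x (u v : T E x), inner ℝ (φ x u) (φ x v) = inner ℝ u v - η x u * η x v
  skew : ∀ x (u v : T E x), inner ℝ u (φ x v) = -inner ℝ (φ x u) v
  eta_eq : ∀ x (u : T E x), inner ℝ u (ξ x) = η x u

/-- `(M, φ, ξ, η, g)` is an `α`-cosymplectic manifold: an almost contact metric manifold with
`dη = 0` and `dΦ = 2α η ∧ Φ` which is normal. -/
structure IsAlphaCosymplectic (α : ℝ) (φ : (x : M) → T E x →L[ℝ] T E x) (ξ : (x : M) → T E x)
    (η : (x : M) → T E x →L[ℝ] ℝ) : Prop where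
  almostContact : IsAlmostContactMetric φ ξ η
  eta_closed : ∀ X Y : (x : M) → T E x, IsSmoothField X → IsSmoothField Y →
    ∀ x, extDerivOne η X Y x = 0
  d_fundamental : ∀ X Y Z : (x : M) → T E x,
    IsSmoothField X → IsSmoothField Y → IsSmoothField Z →
    ∀ x, extDerivTwo (fundamentalForm φ) X Y Z x
      = 2 * α * wedgeOneTwo η (fundamentalForm φ) x (X x) (Y x) (Z x)
  normal : ∀ X Y : (x : M) → T E x, IsSmoothField X → IsSmoothField Y →
    ∀ x, normalityTensor φ ξ η X Y x = 0

/-- A `∗`-`η`-Ricci-Yamabe soliton with potential `ξ` and constants `Λ, μ, ρ, q` with respect to a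
linear connection `D`: `L^D_ξ g + 2ρ S* + (2Λ - q r*) g + 2μ η ⊗ η = 0`, where `L^D_ξ g`, `S*` and
`r*` are formed with `D`. -/
def IsStarEtaRicciYamabeSoliton (D : Connection E M) (φ : (x : M) → T E x →L[ℝ] T E x)
    (ξ : (x : M) → T E x) (η : (x : M) → T E x →L[ℝ] ℝ) (Λ μ ρ q : ℝ) : Prop :=
  ∀ (x : M) (u v : T E x),
    lieMetric D ξ x u v + 2 * ρ * starRicci D φ x u v
      + (2 * Λ - q * starScalarCurv D φ x) * inner ℝ u v + 2 * μ * (η x u * η x v) = 0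

/-- The soliton equation in the form in which `S*` and `r*` are replaced by
`S + α²(n-2) g + α² η ⊗ η` and `r + α²(n-1)²`, where `S` and `r` are the Ricci tensor and the scalar
curvature of `D` and `n = dim M`. -/
def IsReducedStarEtaRicciYamabeSoliton (α : ℝ) (D : Connection E M)
    (ξ : (x : M) → T E x) (η : (x : M) → T E x →L[ℝ] ℝ) (Λ μ ρ q : ℝ) : Prop :=
  ∀ (x : M) (u v : T E x),
    lieMetric D ξ x u v + 2 * ρ * ricci D x u v
      + (2 * Λ + 2 * α ^ 2 * ρ * ((Module.finrank ℝ E : ℝ) - 2) - q * scalarCurv D x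
          - q * α ^ 2 * ((Module.finrank ℝ E : ℝ) - 1) ^ 2) * inner ℝ u v
      + (2 * μ + 2 * α ^ 2 * ρ) * (η x u * η x v) = 0

/-- The connection `D` is metric: `X g(Y,Z) = g(D_X Y, Z) + g(Y, D_X Z)` for all smooth vector
fields. -/
def IsMetric (D : Connection E M) : Prop :=
  ∀ X Y Z : (x : M) → T E x, IsSmoothField X → IsSmoothField Y → IsSmoothField Z →
    ∀ x, dirDeriv X (fun y ↦ inner ℝ (Y y) (Z y)) x
      = inner ℝ (D Y x (X x)) (Z x) + inner ℝ (Y x) (D Z x (X x))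

/-- `D` is the Levi-Civita connection: smooth, torsion-free and metric. -/
structure IsLeviCivita (D : Connection E M) : Prop where
  smooth : CovariantDerivative.ContMDiffCovariantDerivative D ∞
  torsion_free : D.torsion = 0
  metric : IsMetric D

/-- `D` is a quarter-symmetric metric connection: smooth, metric, and with torsion
`T(u,v) = η(v) φ u - η(u) φ v`. -/
structure IsQuarterSymmetricMetric (φ : (x : M) → T E x →L[ℝ] T E x)
    (η : (x : M) → T E x →L[ℝ] ℝ) (D : Connection E M) : Prop where
  smooth : CovariantDerivative.ContMDiffCovariantDerivative D ∞
  torsion_eq : ∀ (x : M) (u v : T E x), D.torsion x u v = η x v • φ x u - η x u • φ x v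
  metric : IsMetric D

end Riemannian

/-- A `∗`-`η`-Einstein soliton: the case `ρ = 1`, `q = -1`. -/
def IsStarEtaEinsteinSoliton [RiemannianBundle (fun x : M ↦ T E x)]
    (D : Connection E M) (φ : (x : M) → T E x →L[ℝ] T E x)
    (ξ : (x : M) → T E x) (η : (x : M) → T E x →L[ℝ] ℝ) (Λ μ : ℝ) : Prop :=
  IsStarEtaRicciYamabeSoliton D φ ξ η Λ μ 1 (-1)

/-- The reduced form of the `∗`-`η`-Einstein soliton equation: the case `ρ = 1`, `q = -1`. -/
def IsReducedStarEtaEinsteinSoliton [RiemannianBundle (fun x : M ↦ T E x)]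
    (α : ℝ) (D : Connection E M)
    (ξ : (x : M) → T E x) (η : (x : M) → T E x →L[ℝ] ℝ) (Λ μ : ℝ) : Prop :=
  IsReducedStarEtaRicciYamabeSoliton α D ξ η Λ μ 1 (-1)

end StarEtaSoliton

end

/-!
The Laplacian of `f` is the divergence of `ξ`, and the divergence of `ξ` is half of the metric trace
of the Lie derivative term, so the theorem is the metric trace of the soliton equation, as soon as
the two scalar curvatures of the quarter-symmetric connection are known. They are
`r̃ = r` and `r̃* = r* = r + α² (n - 1)²`.

The quarter-symmetric metric connection is `D_X Y = ∇_X Y - η(X) φ Y`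
(`IsQuarterSymmetricMetric.covDeriv_eq`), so its curvature differs from that of `∇` by terms in `∇φ`
whose traces vanish (`IsQuarterSymmetricMetric.scalarCurv_eq`,
`IsQuarterSymmetricMetric.starScalarCurv_eq`). For `r*`, normality together with `dη = 0` and
`dΦ = 2α η ∧ Φ` gives `(∇_X φ) Y = α (g(φ X, Y) ξ - η(Y) φ X)` and `∇_X ξ = α (X - η(X) ξ)`
(`IsAlphaCosymplectic.covPhi_eq`, `IsAlphaCosymplectic.covDeriv_xi`). Differentiating once more, the
tensor `K(u,v) w = R(u,v) w + α² (g(v,w) u - g(u,w) v)` commutes with `φ`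
(`IsAlphaCosymplectic.curvature_phi`). As in Kähler geometry, the Bianchi identity then forces the
`∗`-trace of `K` to equal its scalar trace (`star_trace_eq_of_commute`), which is the asserted
relation between `r*` and `r`.

All computations are made with global smooth vector fields. That they compute the pointwise
curvature, which is defined with local extensions, is `curvature_eq`; its only delicate point, the
dependence on the field being differentiated twice, is settled by the skew-symmetry of the curvature
of a metric connection. Skew-symmetry needs `[X,Y] f = X Y f - Y X f`, which follows from the Jacobi
identity (`dirDeriv_mlieBracket`).
-/

set_option linter.unusedSectionVars false

namespace StarEtaSoliton

variable {E : Type*} [NormedAddCommGroup E] [NormedSpace ℝ E] [FiniteDimensional ℝ E]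
  {M : Type*} [TopologicalSpace M] [ChartedSpace E M] [IsManifold 𝓘(ℝ, E) ∞ M]

/-! ### Smooth vector fields -/

lemma isManifold_minSmoothness_two : IsManifold 𝓘(ℝ, E) (minSmoothness ℝ 2) M := by
  rw [minSmoothness_of_isRCLikeNormedField]
  infer_instance

lemma isManifold_minSmoothness_three : IsManifold 𝓘(ℝ, E) (minSmoothness ℝ 3) M := by
  rw [minSmoothness_of_isRCLikeNormedField]
  infer_instance

-- scoped to this namespace, so that the statement of the theorem is elaborated without them
attribute [local instance] isManifold_minSmoothness_two isManifold_minSmoothness_three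

section Fields

variable {X Y Z : (x : M) → T E x} {f : M → ℝ}

lemma smooth_mdiffAt (hf : ContMDiff 𝓘(ℝ, E) 𝓘(ℝ, ℝ) ∞ f) (x : M) :
    MDifferentiableAt 𝓘(ℝ, E) 𝓘(ℝ, ℝ) f x :=
  (hf x).mdifferentiableAt (by simp)

lemma IsSmoothField.mdiffAt (hX : IsSmoothField X) (x : M) :
    MDifferentiableAt 𝓘(ℝ, E) (𝓘(ℝ, E).prod 𝓘(ℝ, E))
      (fun x ↦ (⟨x, X x⟩ : TotalSpace E (fun x : M ↦ T E x))) x :=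
  (hX x).mdifferentiableAt (by simp)

lemma IsSmoothField.add (hX : IsSmoothField X) (hY : IsSmoothField Y) : IsSmoothField (X + Y) :=
  ContMDiff.add_section hX hY

lemma IsSmoothField.sub (hX : IsSmoothField X) (hY : IsSmoothField Y) : IsSmoothField (X - Y) :=
  ContMDiff.sub_section hX hY

lemma IsSmoothField.neg (hX : IsSmoothField X) : IsSmoothField (-X) :=
  ContMDiff.neg_section hX

lemma IsSmoothField.smul (hf : ContMDiff 𝓘(ℝ, E) 𝓘(ℝ, ℝ) ∞ f) (hX : IsSmoothField X) :
    IsSmoothField (f • X) :=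
  ContMDiff.smul_section hf hX

lemma IsSmoothField.const_smul (c : ℝ) (hX : IsSmoothField X) : IsSmoothField (c • X) :=
  ContMDiff.const_smul_section hX

lemma IsSmoothEndo.apply {φ : (x : M) → T E x →L[ℝ] T E x} (hφ : IsSmoothEndo φ)
    (hX : IsSmoothField X) : IsSmoothField (fun y ↦ φ y (X y)) :=
  ContMDiff.clm_bundle_apply (b := fun x : M ↦ x) hφ hX

lemma IsSmoothField.inner [RiemannianBundle (fun x : M ↦ T E x)]
    [IsContMDiffRiemannianBundle 𝓘(ℝ, E) ∞ E (fun x : M ↦ T E x)]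
    (hX : IsSmoothField X) (hY : IsSmoothField Y) :
    ContMDiff 𝓘(ℝ, E) 𝓘(ℝ, ℝ) ∞ (fun y ↦ inner ℝ (X y) (Y y)) :=
  ContMDiff.inner_bundle (b := fun x : M ↦ x) hX hY

lemma IsSmoothField.mlieBracket (hX : IsSmoothField X) (hY : IsSmoothField Y) :
    IsSmoothField (mlieBracket 𝓘(ℝ, E) X Y) := by
  have h : IsManifold 𝓘(ℝ, E) (((⊤ : ℕ∞) : WithTop ℕ∞) + 1) M := by
    simpa using ‹IsManifold 𝓘(ℝ, E) ∞ M›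
  exact ContDiff.mlieBracket_vectorField (m := (⊤ : ℕ∞)) (n := (⊤ : ℕ∞)) hX hY (by simp)

lemma IsSmoothField.covDeriv {D : Connection E M}
    (hD : CovariantDerivative.ContMDiffCovariantDerivative D ∞)
    (hX : IsSmoothField X) (hY : IsSmoothField Y) : IsSmoothField (fun y ↦ D Y y (X y)) := by
  have h := hD.contMDiff.contMDiff (σ := Y)
    (by simpa using! (show IsSmoothField Y from hY).contMDiffOn)
  exact ContMDiff.clm_bundle_apply (b := fun x : M ↦ x) (contMDiffOn_univ.1 h) hX

lemma smooth_dirDeriv (hf : ContMDiff 𝓘(ℝ, E) 𝓘(ℝ, ℝ) ∞ f) (hX : IsSmoothField X) :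
    ContMDiff 𝓘(ℝ, E) 𝓘(ℝ, ℝ) ∞ (dirDeriv X f) := by
  have h := (hf.contMDiff_tangentMap (m := ∞) (by simp)).comp hX
  exact (contMDiff_snd_tangentBundle_modelSpace ℝ 𝓘(ℝ, ℝ)).comp h

/-- Every tangent vector is the value of a global smooth vector field, which can be chosen to agree
near the base point with the local extension used in the definition of `curvature`. -/
lemma exists_smooth_extension [T2Space M] (x : M) (v : T E x) :
    ∃ X : (x : M) → T E x, IsSmoothField X ∧
      X =ᶠ[nhds x] (FiberBundle.extend E v : (x : M) → T E x) := by
  obtain ⟨s, hs, hsX⟩ := FiberBundle.exists_contMDiffOn_extend (k := ∞) 𝓘(ℝ, E) E v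
  obtain ⟨u, hus, hu, hxu⟩ := mem_nhds_iff.1 hs
  obtain ⟨ψ, -, hψ⟩ :=
    (SmoothBumpFunction.nhds_basis_tsupport (I := 𝓘(ℝ, E)) x).mem_iff.1 (hu.mem_nhds hxu)
  refine ⟨(ψ : M → ℝ) • (FiberBundle.extend E v : (x : M) → T E x),
    ContMDiffOn.smul_section_of_tsupport ψ.contMDiff.contMDiffOn hu hψ (hsX.mono hus), ?_⟩
  filter_upwards [ψ.eventuallyEq_one] with y hy
  rw [Pi.smul_apply', hy, Pi.one_apply, one_smul]

end Fields

/-! ### Brackets and covariant derivatives of smooth fields -/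

section Calculus

variable {X Y Z W : (x : M) → T E x} {f : M → ℝ} {D : Connection E M}

lemma exists_smooth_field [T2Space M] (x : M) (v : T E x) :
    ∃ X : (x : M) → T E x, IsSmoothField X ∧ X x = v := by
  obtain ⟨X, hX, h⟩ := exists_smooth_extension x v
  exact ⟨X, hX, h.self_of_nhds.trans (FiberBundle.extend_apply_self E v)⟩

lemma mlieBracket_smul_apply (hf : ContMDiff 𝓘(ℝ, E) 𝓘(ℝ, ℝ) ∞ f) (hY : IsSmoothField Y) (x : M) :
    mlieBracket 𝓘(ℝ, E) X (f • Y) x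
      = dirDeriv X f x • Y x + f x • mlieBracket 𝓘(ℝ, E) X Y x :=
  mlieBracket_smul_right (smooth_mdiffAt hf x) (hY.mdiffAt x)

lemma jacobi_mlieBracket (hX : IsSmoothField X) (hY : IsSmoothField Y) (hZ : IsSmoothField Z)
    (x : M) :
    mlieBracket 𝓘(ℝ, E) X (mlieBracket 𝓘(ℝ, E) Y Z) x =
      mlieBracket 𝓘(ℝ, E) (mlieBracket 𝓘(ℝ, E) X Y) Z x
        + mlieBracket 𝓘(ℝ, E) Y (mlieBracket 𝓘(ℝ, E) X Z) x := by
  apply leibniz_identity_mlieBracket_apply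
  · rw [minSmoothness_of_isRCLikeNormedField]; exact (hX x).of_le (by norm_cast)
  · rw [minSmoothness_of_isRCLikeNormedField]; exact (hY x).of_le (by norm_cast)
  · rw [minSmoothness_of_isRCLikeNormedField]; exact (hZ x).of_le (by norm_cast)

/-- The bracket of vector fields is the commutator of the derivations that they define. This is read
off from the Jacobi identity for `X`, `Y` and `f Z`, where `Z` is arbitrary. -/
lemma dirDeriv_mlieBracket [T2Space M] (hX : IsSmoothField X) (hY : IsSmoothField Y)
    (hf : ContMDiff 𝓘(ℝ, E) 𝓘(ℝ, ℝ) ∞ f) (x : M) :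
    dirDeriv (mlieBracket 𝓘(ℝ, E) X Y) f x
      = dirDeriv X (dirDeriv Y f) x - dirDeriv Y (dirDeriv X f) x := by
  have key : ∀ z : T E x, (dirDeriv (mlieBracket 𝓘(ℝ, E) X Y) f x
      - (dirDeriv X (dirDeriv Y f) x - dirDeriv Y (dirDeriv X f) x)) • z = 0 := by
    intro z
    obtain ⟨Z, hZ, rfl⟩ := exists_smooth_field x z
    have h := jacobi_mlieBracket hX hY (hZ.smul hf) x
    have e : ∀ V : (x : M) → T E x, mlieBracket 𝓘(ℝ, E) V (f • Z)
        = dirDeriv V f • Z + f • mlieBracket 𝓘(ℝ, E) V Z := fun V ↦ by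
      ext1 y
      exact mlieBracket_smul_apply hf hZ y
    have e2 : ∀ V V' : (x : M) → T E x, IsSmoothField V' →
        mlieBracket 𝓘(ℝ, E) V (mlieBracket 𝓘(ℝ, E) V' (f • Z)) x
        = dirDeriv V (dirDeriv V' f) x • Z x + dirDeriv V' f x • mlieBracket 𝓘(ℝ, E) V Z x
          + (dirDeriv V f x • mlieBracket 𝓘(ℝ, E) V' Z x
          + f x • mlieBracket 𝓘(ℝ, E) V (mlieBracket 𝓘(ℝ, E) V' Z) x) := fun V V' hV' ↦ by
      rw [e V', mlieBracket_add_right ((hZ.smul (smooth_dirDeriv hf hV')).mdiffAt x)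
        (((hV'.mlieBracket hZ).smul hf).mdiffAt x),
        mlieBracket_smul_apply (smooth_dirDeriv hf hV') hZ,
        mlieBracket_smul_apply hf (hV'.mlieBracket hZ)]
    rw [e2 X Y hY, e2 Y X hX, mlieBracket_smul_apply hf hZ, jacobi_mlieBracket hX hY hZ x] at h
    have h' := sub_eq_zero.2 h.symm
    rw [← h']
    module
  by_cases hz : ∃ z : T E x, z ≠ 0
  · obtain ⟨z, hz⟩ := hz
    exact sub_eq_zero.1 ((smul_eq_zero.1 (key z)).resolve_right hz)
  · push Not at hz
    simp [dirDeriv, hz (X x), hz (Y x), hz (mlieBracket 𝓘(ℝ, E) X Y x)]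

lemma covDeriv_add (D : Connection E M) (hY : IsSmoothField Y) (hZ : IsSmoothField Z) (x : M)
    (u : T E x) : D (Y + Z) x u = D Y x u + D Z x u := by
  rw [D.isCovariantDerivativeOnUniv.add (hY.mdiffAt x) (hZ.mdiffAt x)]
  rfl

lemma covDeriv_smul (D : Connection E M) (hf : ContMDiff 𝓘(ℝ, E) 𝓘(ℝ, ℝ) ∞ f)
    (hY : IsSmoothField Y) (x : M) (u : T E x) :
    D (f • Y) x u = f x • D Y x u + mvfderiv 𝓘(ℝ, E) f x u • Y x := by
  rw [D.isCovariantDerivativeOnUniv.leibniz (hY.mdiffAt x) (smooth_mdiffAt hf x)]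
  rfl

lemma covDeriv_const_smul (D : Connection E M) (c : ℝ) (hY : IsSmoothField Y) (x : M) (u : T E x) :
    D (c • Y) x u = c • D Y x u := by
  rw [D.isCovariantDerivativeOnUniv.smul_const c (hY.mdiffAt x)]
  rfl

lemma covDeriv_neg (D : Connection E M) (hY : IsSmoothField Y) (x : M) (u : T E x) :
    D (-Y) x u = -D Y x u := by
  have := covDeriv_const_smul D (-1) hY x u
  simpa using this

lemma covDeriv_sub (D : Connection E M) (hY : IsSmoothField Y) (hZ : IsSmoothField Z) (x : M)
    (u : T E x) : D (Y - Z) x u = D Y x u - D Z x u := by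
  rw [sub_eq_add_neg, covDeriv_add D hY hZ.neg, covDeriv_neg D hZ, sub_eq_add_neg]

/-- The covariant derivative depends only on the germ of the field. -/
lemma covDeriv_congr (D : Connection E M) {x : M} (hY : IsSmoothField Y) (h : Z =ᶠ[nhds x] Y) :
    D Z x = D Y x := by
  refine D.isCovariantDerivativeOnUniv.congr_of_eventuallyEq ?_ (hY.mdiffAt x) Filter.univ_mem h
  refine (hY.mdiffAt x).congr_of_eventuallyEq ?_
  filter_upwards [h] with y hy
  rw [hy]

end Calculus

/-! ### The curvature tensor of a metric connection -/

section Curvature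

variable [T2Space M] [RiemannianBundle (fun x : M ↦ T E x)]
  [IsContMDiffRiemannianBundle 𝓘(ℝ, E) ∞ E (fun x : M ↦ T E x)]
  {X Y Z W : (x : M) → T E x} {D : Connection E M}

lemma IsMetric.deriv_inner (hm : IsMetric D) (hY : IsSmoothField Y) (hZ : IsSmoothField Z) (x : M)
    (u : T E x) :
    mvfderiv 𝓘(ℝ, E) (fun y ↦ inner ℝ (Y y) (Z y)) x u
      = inner ℝ (D Y x u) (Z x) + inner ℝ (Y x) (D Z x u) := by
  obtain ⟨X, hX, rfl⟩ := exists_smooth_field x u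
  exact hm X Y Z hX hY hZ x

lemma curvatureField_antisymm (X Y Z : (x : M) → T E x) (x : M) :
    curvatureField D X Y Z x = -curvatureField D Y X Z x := by
  simp only [curvatureField]
  rw [mlieBracket_swap (V := Y), Pi.neg_apply, map_neg]
  abel

/-- The curvature of a metric connection is skew-symmetric. -/
lemma inner_curvatureField (hs : CovariantDerivative.ContMDiffCovariantDerivative D ∞)
    (hm : IsMetric D) (hX : IsSmoothField X)
    (hY : IsSmoothField Y) (hZ : IsSmoothField Z) (hW : IsSmoothField W) (x : M) :
    inner ℝ (curvatureField D X Y Z x) (W x) = -inner ℝ (Z x) (curvatureField D X Y W x) := by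
  have h := dirDeriv_mlieBracket hX hY (hZ.inner hW) x
  have e : ∀ V : (x : M) → T E x, dirDeriv V (fun y ↦ inner ℝ (Z y) (W y))
      = (fun y ↦ inner ℝ (D Z y (V y)) (W y)) + fun y ↦ inner ℝ (Z y) (D W y (V y)) := fun V ↦ by
    ext1 y
    exact hm.deriv_inner hZ hW y (V y)
  have e2 : ∀ V V' : (x : M) → T E x, IsSmoothField V → IsSmoothField V' →
      dirDeriv V (dirDeriv V' (fun y ↦ inner ℝ (Z y) (W y))) x
      = inner ℝ (D (fun y ↦ D Z y (V' y)) x (V x)) (W x) + inner ℝ (D Z x (V' x)) (D W x (V x))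
        + (inner ℝ (D Z x (V x)) (D W x (V' x))
          + inner ℝ (Z x) (D (fun y ↦ D W y (V' y)) x (V x))) := fun V V' hV hV' ↦ by
    have s1 := (hV'.covDeriv hs hZ)
    have s2 := (hV'.covDeriv hs hW)
    rw [e V', dirDeriv, mvfderiv_add (smooth_mdiffAt (s1.inner hW) x)
      (smooth_mdiffAt (hZ.inner s2) x), add_apply,
      hm.deriv_inner s1 hW, hm.deriv_inner hZ s2]
  rw [e2 X Y hX hY, e2 Y X hY hX, e] at h
  simp only [curvatureField, inner_sub_left, inner_sub_right, Pi.add_apply] at h ⊢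
  linarith

/-- Tensoriality in the first argument; the second follows by antisymmetry. -/
lemma curvatureField_tensorial (hs : CovariantDerivative.ContMDiffCovariantDerivative D ∞)
    (hZ : IsSmoothField Z) (Y : (x : M) → T E x) (x : M) :
    TensorialAt 𝓘(ℝ, E) E (V := fun x : M ↦ T E x) (fun X ↦ curvatureField D X Y Z x) x := by
  have hDZ : MDifferentiableAt 𝓘(ℝ, E) (𝓘(ℝ, E).prod 𝓘(ℝ, E →L[ℝ] E))
      (fun y ↦ (⟨y, D Z y⟩ : TotalSpace (E →L[ℝ] E) (fun x : M ↦ T E x →L[ℝ] T E x))) x := by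
    have h := hs.contMDiff.contMDiff (σ := Z)
      (by simpa using! (show IsSmoothField Z from hZ).contMDiffOn)
    exact (contMDiffOn_univ.1 h x).mdifferentiableAt (by simp)
  have hd : ∀ {V : (x : M) → T E x}, MDifferentiableAt 𝓘(ℝ, E) (𝓘(ℝ, E).prod 𝓘(ℝ, E))
        (fun x ↦ (⟨x, V x⟩ : TotalSpace E (fun x : M ↦ T E x))) x →
      MDifferentiableAt 𝓘(ℝ, E) (𝓘(ℝ, E).prod 𝓘(ℝ, E))
        (fun y ↦ (⟨y, D Z y (V y)⟩ : TotalSpace E (fun x : M ↦ T E x))) x := fun hV ↦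
    MDifferentiableAt.clm_bundle_apply (b := fun x : M ↦ x) hDZ hV
  constructor
  · intro f V hf hV
    have e : (fun y ↦ D Z y ((f • V) y)) = f • fun y ↦ D Z y (V y) := by
      ext1 y
      exact map_smul (D Z y) (f y) (V y)
    simp only [curvatureField, e]
    rw [D.isCovariantDerivativeOnUniv.leibniz (hd hV) hf, mlieBracket_smul_left hf hV]
    simp
    module
  · intro V V' hV hV'
    have e : (fun y ↦ D Z y ((V + V') y)) = (fun y ↦ D Z y (V y)) + fun y ↦ D Z y (V' y) := by
      ext1 y
      exact map_add (D Z y) (V y) (V' y)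
    simp only [curvatureField, e]
    rw [D.isCovariantDerivativeOnUniv.add (hd hV) (hd hV'), mlieBracket_add_left hV hV']
    simp
    module

/-- The curvature of smooth fields depends only on their values at the point. In the third argument
this is read off from skew-symmetry, `g(R(X,Y)Z, W) = -g(Z, R(X,Y)W)`. -/
lemma curvatureField_congr (hs : CovariantDerivative.ContMDiffCovariantDerivative D ∞)
    (hm : IsMetric D) {X' Y' Z' : (x : M) → T E x}
    (hX : IsSmoothField X) (hY : IsSmoothField Y) (hZ : IsSmoothField Z)
    (hX' : IsSmoothField X') (hY' : IsSmoothField Y') (hZ' : IsSmoothField Z') {x : M}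
    (eX : X x = X' x) (eY : Y x = Y' x) (eZ : Z x = Z' x) :
    curvatureField D X Y Z x = curvatureField D X' Y' Z' x := by
  have h1 : ∀ {V V' V'' : (x : M) → T E x}, IsSmoothField V → IsSmoothField V' →
      V x = V' x → curvatureField D V V'' Z x = curvatureField D V' V'' Z x :=
    fun hV hV' e ↦ (curvatureField_tensorial hs hZ _ x).pointwise (hV.mdiffAt x)
      (hV'.mdiffAt x) e
  rw [h1 hX hX' eX, curvatureField_antisymm, h1 hY hY' eY, ← curvatureField_antisymm]
  refine ext_inner_right ℝ fun w ↦ ?_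
  obtain ⟨W, hW, rfl⟩ := exists_smooth_field x w
  rw [inner_curvatureField hs hm hX' hY' hZ hW, inner_curvatureField hs hm hX' hY' hZ' hW, eZ]

/-- The curvature tensor at a point is computed by arbitrary smooth extensions of the vectors. -/
lemma curvature_eq (hs : CovariantDerivative.ContMDiffCovariantDerivative D ∞) (hm : IsMetric D)
    (hX : IsSmoothField X) (hY : IsSmoothField Y) (hZ : IsSmoothField Z) (x : M) :
    curvature D x (X x) (Y x) (Z x) = curvatureField D X Y Z x := by
  obtain ⟨X', hX', eX⟩ := exists_smooth_extension x (X x)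
  obtain ⟨Y', hY', eY⟩ := exists_smooth_extension x (Y x)
  obtain ⟨Z', hZ', eZ⟩ := exists_smooth_extension x (Z x)
  have vX : X x = X' x := (FiberBundle.extend_apply_self E (X x)).symm.trans eX.self_of_nhds.symm
  have vY : Y x = Y' x := (FiberBundle.extend_apply_self E (Y x)).symm.trans eY.self_of_nhds.symm
  have vZ : Z x = Z' x := (FiberBundle.extend_apply_self E (Z x)).symm.trans eZ.self_of_nhds.symm
  rw [curvatureField_congr hs hm hX hY hZ hX' hY' hZ' vX vY vZ]
  have hDZ : ∀ᶠ y in nhds x, D (FiberBundle.extend E (Z x) : (x : M) → T E x) y = D Z' y := by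
    filter_upwards [eZ.eventuallyEq_nhds] with y hy
    exact covDeriv_congr D hZ' hy.symm
  have h1 : ∀ {V V' : (x : M) → T E x}, IsSmoothField V' → V' =ᶠ[nhds x] V →
      D (fun y ↦ D (FiberBundle.extend E (Z x) : (x : M) → T E x) y (V y)) x
        = D (fun y ↦ D Z' y (V' y)) x := fun hV' e ↦ by
    refine covDeriv_congr D (hV'.covDeriv hs hZ') ?_
    filter_upwards [hDZ, e] with y h1 h2
    rw [h1, h2]
  simp only [curvature, curvatureField]
  rw [h1 hX' eX, h1 hY' eY, hDZ.self_of_nhds,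
    Filter.EventuallyEq.mlieBracket_vectorField_eq eX.symm eY.symm]
  simp only [FiberBundle.extend_apply_self, ← vX, ← vY]

lemma curvature_antisymm (D : Connection E M) (x : M) (u v w : T E x) :
    curvature D x u v w = -curvature D x v u w :=
  curvatureField_antisymm _ _ _ x

lemma inner_curvature (hs : CovariantDerivative.ContMDiffCovariantDerivative D ∞)
    (hm : IsMetric D) (x : M) (u v w z : T E x) :
    inner ℝ (curvature D x u v w) z = -inner ℝ w (curvature D x u v z) := by
  obtain ⟨X, hX, rfl⟩ := exists_smooth_field x u
  obtain ⟨Y, hY, rfl⟩ := exists_smooth_field x v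
  obtain ⟨Z, hZ, rfl⟩ := exists_smooth_field x w
  obtain ⟨W, hW, rfl⟩ := exists_smooth_field x z
  rw [curvature_eq hs hm hX hY hZ, curvature_eq hs hm hX hY hW,
    inner_curvatureField hs hm hX hY hZ hW]

lemma curvature_isLinearMap_left (hs : CovariantDerivative.ContMDiffCovariantDerivative D ∞)
    (hm : IsMetric D) (x : M) (v w : T E x) : IsLinearMap ℝ (fun u ↦ curvature D x u v w) := by
  obtain ⟨Y, hY, rfl⟩ := exists_smooth_field x v
  obtain ⟨Z, hZ, rfl⟩ := exists_smooth_field x w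
  have ht := curvatureField_tensorial hs hZ Y x
  constructor
  · intro u u'
    obtain ⟨X, hX, rfl⟩ := exists_smooth_field x u
    obtain ⟨X', hX', rfl⟩ := exists_smooth_field x u'
    rw [← Pi.add_apply, curvature_eq hs hm (hX.add hX') hY hZ, curvature_eq hs hm hX hY hZ,
      curvature_eq hs hm hX' hY hZ]
    exact ht.add (hX.mdiffAt x) (hX'.mdiffAt x)
  · intro c u
    obtain ⟨X, hX, rfl⟩ := exists_smooth_field x u
    rw [← Pi.smul_apply, curvature_eq hs hm (hX.const_smul c) hY hZ, curvature_eq hs hm hX hY hZ]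
    exact ht.smul (f := fun _ ↦ c) mdifferentiableAt_const (hX.mdiffAt x)

lemma curvature_isLinearMap_right (hs : CovariantDerivative.ContMDiffCovariantDerivative D ∞)
    (hm : IsMetric D) (x : M) (u v : T E x) : IsLinearMap ℝ (fun w ↦ curvature D x u v w) := by
  constructor
  · intro w w'
    refine ext_inner_right ℝ fun z ↦ ?_
    simp only [inner_curvature hs hm, inner_add_left]
    ring
  · intro c w
    refine ext_inner_right ℝ fun z ↦ ?_
    simp only [inner_curvature hs hm, inner_smul_left]
    simp

/-- The Levi-Civita connection is torsion-free on smooth fields. -/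
lemma IsLeviCivita.mlieBracket_eq (h : IsLeviCivita D) (hX : IsSmoothField X)
    (hY : IsSmoothField Y) (x : M) :
    mlieBracket 𝓘(ℝ, E) X Y x = D Y x (X x) - D X x (Y x) :=
  (D.torsion_eq_zero_iff.1 h.torsion_free (hX.mdiffAt x) (hY.mdiffAt x)).symm

/-- The first Bianchi identity, obtained from the Jacobi identity. -/
lemma IsLeviCivita.bianchi (h : IsLeviCivita D) (x : M) (u v w : T E x) :
    curvature D x u v w + curvature D x v w u + curvature D x w u v = 0 := by
  have hs := h.smooth
  obtain ⟨X, hX, rfl⟩ := exists_smooth_field x u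
  obtain ⟨Y, hY, rfl⟩ := exists_smooth_field x v
  obtain ⟨Z, hZ, rfl⟩ := exists_smooth_field x w
  rw [curvature_eq hs h.metric hX hY hZ, curvature_eq hs h.metric hY hZ hX,
    curvature_eq hs h.metric hZ hX hY]
  have e : ∀ {A B C : (x : M) → T E x}, IsSmoothField A → IsSmoothField B → IsSmoothField C →
      mlieBracket 𝓘(ℝ, E) A (mlieBracket 𝓘(ℝ, E) B C) x
        = D (fun y ↦ D C y (B y)) x (A x) - D (fun y ↦ D B y (C y)) x (A x)
          - D A x (mlieBracket 𝓘(ℝ, E) B C x) := fun {A B C} hA hB hC ↦ by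
    have e1 : mlieBracket 𝓘(ℝ, E) B C = (fun y ↦ D C y (B y)) - fun y ↦ D B y (C y) := by
      ext1 y
      exact h.mlieBracket_eq hB hC y
    rw [h.mlieBracket_eq hA (hB.mlieBracket hC), e1,
      covDeriv_sub D (hB.covDeriv hs hC) (hC.covDeriv hs hB)]
  have j := jacobi_mlieBracket hX hY hZ x
  have s1 : mlieBracket 𝓘(ℝ, E) (mlieBracket 𝓘(ℝ, E) X Y) Z x
      = -mlieBracket 𝓘(ℝ, E) Z (mlieBracket 𝓘(ℝ, E) X Y) x := by
    rw [mlieBracket_swap, Pi.neg_apply]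
  have s2 : mlieBracket 𝓘(ℝ, E) Y (mlieBracket 𝓘(ℝ, E) X Z) x
      = -mlieBracket 𝓘(ℝ, E) Y (mlieBracket 𝓘(ℝ, E) Z X) x := by
    have : mlieBracket 𝓘(ℝ, E) X Z = (-1 : ℝ) • mlieBracket 𝓘(ℝ, E) Z X := by
      rw [mlieBracket_swap, neg_one_smul]
    rw [this, mlieBracket_const_smul_right ((hZ.mlieBracket hX).mdiffAt x), neg_one_smul]
  rw [s1, s2, e hX hY hZ, e hY hZ hX, e hZ hX hY] at j
  have j' := sub_eq_zero.2 j
  rw [← j']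
  simp only [curvatureField]
  abel

end Curvature

/-! ### The covariant derivative of the structure tensors -/

section Structure

variable [T2Space M] [RiemannianBundle (fun x : M ↦ T E x)]
  [IsContMDiffRiemannianBundle 𝓘(ℝ, E) ∞ E (fun x : M ↦ T E x)]
  {X Y Z W : (x : M) → T E x} {D : Connection E M} {α : ℝ}
  {φ : (x : M) → T E x →L[ℝ] T E x} {ξ : (x : M) → T E x} {η : (x : M) → T E x →L[ℝ] ℝ}

/-- The covariant derivative `(D_u φ) Y = D_u (φ Y) - φ (D_u Y)` of the structure tensor. -/
noncomputable def covPhi (D : Connection E M) (φ : (x : M) → T E x →L[ℝ] T E x)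
    (Y : (x : M) → T E x) (x : M) (u : T E x) : T E x :=
  D (fun y ↦ φ y (Y y)) x u - φ x (D Y x u)

namespace IsAlmostContactMetric

variable (h : IsAlmostContactMetric φ ξ η)
include h

lemma norm_xi (x : M) : inner ℝ (ξ x) (ξ x) = 1 := by rw [h.eta_eq, h.eta_xi]

lemma inner_xi_left (x : M) (u : T E x) : inner ℝ (ξ x) u = η x u := by
  rw [real_inner_comm, h.eta_eq]

lemma inner_phi_right (x : M) (u v : T E x) : inner ℝ u (φ x v) = -inner ℝ v (φ x u) := by
  rw [h.skew, real_inner_comm]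

lemma smooth_eta (hY : IsSmoothField Y) :
    ContMDiff 𝓘(ℝ, E) 𝓘(ℝ, ℝ) ∞ (fun y ↦ η y (Y y)) := by
  simpa only [h.eta_eq] using hY.inner h.smooth_xi

lemma deriv_eta (hm : IsMetric D) (hY : IsSmoothField Y) (x : M) (u : T E x) :
    mvfderiv 𝓘(ℝ, E) (fun y ↦ η y (Y y)) x u = η x (D Y x u) + inner ℝ (Y x) (D ξ x u) := by
  rw [← h.eta_eq, ← hm.deriv_inner hY h.smooth_xi]
  simp only [h.eta_eq]

lemma eta_covDeriv_xi (hm : IsMetric D) (x : M) (u : T E x) : η x (D ξ x u) = 0 := by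
  have e := hm.deriv_inner h.smooth_xi h.smooth_xi x u
  simp only [h.norm_xi, h.eta_eq, h.inner_xi_left, mvfderiv_const, zero_apply] at e
  linarith

lemma inner_covPhi (hm : IsMetric D) (hY : IsSmoothField Y) (hZ : IsSmoothField Z) (x : M)
    (u : T E x) : inner ℝ (covPhi D φ Y x u) (Z x) = -inner ℝ (covPhi D φ Z x u) (Y x) := by
  rw [real_inner_comm (Y x)]
  have e1 := hm.deriv_inner (h.smooth_phi.apply hY) hZ x u
  have e2 := hm.deriv_inner hY (h.smooth_phi.apply hZ) x u
  have e : (fun y ↦ inner ℝ (Y y) (φ y (Z y))) = -fun y ↦ inner ℝ (φ y (Y y)) (Z y) := by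
    ext1 y
    exact h.skew y _ _
  rw [e, mvfderiv_neg, neg_apply, e1] at e2
  simp only [covPhi, inner_sub_left, inner_sub_right, h.skew] at e2 ⊢
  linarith

/-- The covariant derivative of the identity `φ² = -id + η ⊗ ξ`. -/
lemma phi_covPhi (hm : IsMetric D) (hY : IsSmoothField Y) (x : M) (u : T E x) :
    φ x (covPhi D φ Y x u) + covPhi D φ (fun y ↦ φ y (Y y)) x u
      = inner ℝ (D ξ x u) (Y x) • ξ x + η x (Y x) • D ξ x u := by
  have e : (fun y ↦ φ y (φ y (Y y))) = -Y + (fun y ↦ η y (Y y)) • ξ := by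
    ext1 y
    exact h.phi_sq y _
  simp only [covPhi, map_sub]
  rw [e, h.phi_sq, covDeriv_add D hY.neg (h.smooth_xi.smul (h.smooth_eta hY)), covDeriv_neg D hY,
    covDeriv_smul D (h.smooth_eta hY) h.smooth_xi, h.deriv_eta hm hY, real_inner_comm]
  module

lemma covPhi_xi (x : M) (u : T E x) : covPhi D φ ξ x u = -φ x (D ξ x u) := by
  have e : (fun y ↦ φ y (ξ y)) = 0 := by
    ext1 y
    exact h.phi_xi y
  rw [covPhi, e, D.zero]
  simp

end IsAlmostContactMetric

namespace IsAlphaCosymplectic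

variable (h : IsAlphaCosymplectic α φ ξ η)
include h

/-- `∇ξ` is symmetric, since `η` is closed. -/
lemma inner_covDeriv_xi_symm (hD : IsLeviCivita D) (x : M) (u v : T E x) :
    inner ℝ (D ξ x u) v = inner ℝ (D ξ x v) u := by
  have hc := h.almostContact
  obtain ⟨X, hX, rfl⟩ := exists_smooth_field x u
  obtain ⟨Y, hY, rfl⟩ := exists_smooth_field x v
  have e := h.eta_closed X Y hX hY x
  rw [extDerivOne, dirDeriv, dirDeriv, hc.deriv_eta hD.metric hY, hc.deriv_eta hD.metric hX,
    hD.mlieBracket_eq hX hY, map_sub] at e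
  rw [real_inner_comm, real_inner_comm (X x)]
  linarith

/-- The exterior derivative of `Φ` is the cyclic sum of `∇φ`. -/
lemma covPhi_cyclic (hD : IsLeviCivita D) (hX : IsSmoothField X) (hY : IsSmoothField Y)
    (hZ : IsSmoothField Z) (x : M) :
    inner ℝ (covPhi D φ Y x (X x)) (Z x) + inner ℝ (covPhi D φ Z x (Y x)) (X x)
      + inner ℝ (covPhi D φ X x (Z x)) (Y x)
      = 2 * α * wedgeOneTwo η (fundamentalForm φ) x (X x) (Y x) (Z x) := by
  have hc := h.almostContact
  rw [← h.d_fundamental X Y Z hX hY hZ x]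
  simp only [extDerivTwo, fundamentalForm, dirDeriv]
  rw [hD.metric.deriv_inner (hc.smooth_phi.apply hY) hZ,
    hD.metric.deriv_inner (hc.smooth_phi.apply hZ) hX,
    hD.metric.deriv_inner (hc.smooth_phi.apply hX) hY,
    hD.mlieBracket_eq hX hY, hD.mlieBracket_eq hY hZ, hD.mlieBracket_eq hZ hX]
  have s : ∀ u v : T E x, inner ℝ (φ x u) v = -inner ℝ (φ x v) u := fun u v ↦ by
    rw [← hc.skew, real_inner_comm]
  simp only [covPhi, map_sub, inner_sub_left]
  rw [s (Y x) (D Z x (X x)), s (Z x) (D X x (Y x)), s (X x) (D Y x (Z x))]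
  ring

/-- Normality, expressed through `∇φ`. -/
lemma covPhi_normal (hD : IsLeviCivita D) (hX : IsSmoothField X) (hY : IsSmoothField Y) (x : M) :
    covPhi D φ Y x (φ x (X x)) - covPhi D φ X x (φ x (Y x))
      - φ x (covPhi D φ Y x (X x)) + φ x (covPhi D φ X x (Y x)) = 0 := by
  have hc := h.almostContact
  have pX := hc.smooth_phi.apply hX
  have pY := hc.smooth_phi.apply hY
  rw [← h.normal X Y hX hY x, normalityTensor, h.eta_closed X Y hX hY,
    hD.mlieBracket_eq pX pY, hD.mlieBracket_eq pX hY, hD.mlieBracket_eq hX pY,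
    hD.mlieBracket_eq hX hY]
  simp only [covPhi, map_sub, zero_smul]
  abel

/-- On an `α`-cosymplectic manifold `(∇_X φ) Y = α (g(φ X, Y) ξ - η(Y) φ X)`. Writing
`a(X,Y,Z) = g((∇_X φ) Y, Z)`, the formula results from subtracting the equation for `dΦ` at
`(X, φY, φZ)` from the one at `(X, Y, Z)`: the relation between `φ (∇φ)` and `(∇φ) φ` doubles
`a(X,Y,Z)`, and normality, together with the symmetry of `∇ξ`, cancels the remaining terms. -/
lemma covPhi_eq (hD : IsLeviCivita D) (hY : IsSmoothField Y) (x : M) (u : T E x) :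
    covPhi D φ Y x u = α • (inner ℝ (φ x u) (Y x) • ξ x - η x (Y x) • φ x u) := by
  have hc := h.almostContact
  refine ext_inner_right ℝ fun w ↦ ?_
  obtain ⟨X, hX, rfl⟩ := exists_smooth_field x u
  obtain ⟨Z, hZ, rfl⟩ := exists_smooth_field x w
  have pX := hc.smooth_phi.apply hX
  have pY := hc.smooth_phi.apply hY
  have pZ := hc.smooth_phi.apply hZ
  have hm := hD.metric
  have c1 := h.covPhi_cyclic hD hX hY hZ x
  have c2 := h.covPhi_cyclic hD hX pY pZ x
  -- the normality condition for `Y` and `Z`, paired with `φ X`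
  have n1 := congrArg (fun v ↦ inner ℝ v (φ x (X x))) (h.covPhi_normal hD hY hZ x)
  have r1 := congrArg (fun v ↦ inner ℝ v (φ x (Z x))) (hc.phi_covPhi hm hY x (X x))
  have r2 := congrArg (fun v ↦ inner ℝ v (X x)) (hc.phi_covPhi hm hZ x (φ x (Y x)))
  have r3 := congrArg (fun v ↦ inner ℝ v (X x)) (hc.phi_covPhi hm hY x (φ x (Z x)))
  have k1 := hc.inner_covPhi hm hX pY x (φ x (Z x))
  have k2 := hc.inner_covPhi hm hX hY x (Z x)
  have x1 := hc.inner_covPhi hm hY hc.smooth_xi x (X x)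
  have x2 := hc.inner_covPhi hm hY hc.smooth_xi x (Z x)
  have x3 := hc.inner_covPhi hm hZ hc.smooth_xi x (Y x)
  have x4 := h.inner_covDeriv_xi_symm hD x (φ x (Z x)) (Y x)
  have x5 := h.inner_covDeriv_xi_symm hD x (φ x (Y x)) (Z x)
  have x6 := h.inner_covDeriv_xi_symm hD x (φ x (Y x)) (X x)
  have x7 := h.inner_covDeriv_xi_symm hD x (φ x (Z x)) (X x)
  have p1 := hc.inner_phi_right x (X x) (Y x)
  have p2 := hc.inner_phi_right x (X x) (Z x)
  have p3 := hc.inner_phi_right x (Y x) (Z x)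
  have hr : ∀ v w : T E x, inner ℝ (φ x v) w = -inner ℝ v (φ x w) := fun v w ↦ by
    rw [hc.skew, neg_neg]
  simp only [wedgeOneTwo, fundamentalForm, map_neg, inner_add_left, inner_sub_left, inner_smul_left,
    inner_neg_left, inner_zero_left, hr,
    hc.phi_sq, hc.eta_phi, inner_neg_right, hc.inner_xi_left, hc.covPhi_xi, hc.eta_eq,
    RCLike.conj_to_real, inner_add_right, inner_smul_right] at *
  linear_combination (c1 - c2 + r1 + r2 - r3 + k1 + n1 - k2
    + η x (X x) * (x5 - x4 - x3 + x2) - η x (Y x) * x7 + η x (Z x) * (x6 + x1)) / 2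
    - α * η x (Y x) * p2

lemma covDeriv_phi (hD : IsLeviCivita D) (hY : IsSmoothField Y) (x : M) (u : T E x) :
    D (fun y ↦ φ y (Y y)) x u
      = φ x (D Y x u) + α • (inner ℝ (φ x u) (Y x) • ξ x - η x (Y x) • φ x u) := by
  rw [← h.covPhi_eq hD hY, covPhi, add_sub_cancel]

/-- On an `α`-cosymplectic manifold `∇_X ξ = α (X - η(X) ξ)`. -/
lemma covDeriv_xi (hD : IsLeviCivita D) (x : M) (u : T E x) :
    D ξ x u = α • (u - η x u • ξ x) := by
  have hc := h.almostContact
  have e := congrArg (φ x) ((hc.covPhi_xi (D := D) x u).symm.trans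
    (h.covPhi_eq hD hc.smooth_xi x u))
  simp only [hc.eta_eq, hc.eta_phi, hc.eta_xi, map_neg, map_smul, map_sub, hc.phi_sq,
    hc.eta_covDeriv_xi hD.metric, hc.phi_xi] at e
  have e' := sub_eq_zero.2 e
  rw [← sub_eq_zero, ← e']
  module

/-- The commutator of the curvature with `φ`. It says that `R(u,v) w + α² (g(v,w) u - g(u,w) v)`
commutes with `φ`. -/
lemma curvature_phi (hD : IsLeviCivita D) (x : M) (u v w : T E x) :
    curvature D x u v (φ x w) = φ x (curvature D x u v w)
      + α ^ 2 • (inner ℝ v w • φ x u - inner ℝ u w • φ x v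
        - inner ℝ v (φ x w) • u + inner ℝ u (φ x w) • v) := by
  have hc := h.almostContact
  have hm := hD.metric
  obtain ⟨X, hX, rfl⟩ := exists_smooth_field x u
  obtain ⟨Y, hY, rfl⟩ := exists_smooth_field x v
  obtain ⟨Z, hZ, rfl⟩ := exists_smooth_field x w
  have pZ := hc.smooth_phi.apply hZ
  rw [curvature_eq hD.smooth hm hX hY pZ, curvature_eq hD.smooth hm hX hY hZ]
  -- the second derivative of `φ Z`, expanded by the formulas for `∇φ` and `∇ξ`
  have e : ∀ {V : (x : M) → T E x} (u : T E x), IsSmoothField V →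
      D (fun y ↦ D (fun y ↦ φ y (Z y)) y (V y)) x u
      = φ x (D (fun y ↦ D Z y (V y)) x u)
        + α • (inner ℝ (φ x u) (D Z x (V x)) • ξ x - η x (D Z x (V x)) • φ x u)
        + α • (inner ℝ (φ x (V x)) (Z x) • (α • (u - η x u • ξ x))
          + (inner ℝ (φ x (D V x u) + α • (inner ℝ (φ x u) (V x) • ξ x - η x (V x) • φ x u)) (Z x)
            + inner ℝ (φ x (V x)) (D Z x u)) • ξ x
          - (η x (Z x) • (φ x (D V x u)
              + α • (inner ℝ (φ x u) (V x) • ξ x - η x (V x) • φ x u))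
            + (η x (D Z x u) + inner ℝ (Z x) (α • (u - η x u • ξ x))) • φ x (V x))) := by
    intro V u hV
    have pV := hc.smooth_phi.apply hV
    have dV := hV.covDeriv hD.smooth hZ
    have e1 : (fun y ↦ D (fun y ↦ φ y (Z y)) y (V y))
        = (fun y ↦ φ y (D Z y (V y))) + α • ((fun y ↦ inner ℝ (φ y (V y)) (Z y)) • ξ
            - (fun y ↦ η y (Z y)) • fun y ↦ φ y (V y)) := by
      ext1 y
      exact h.covDeriv_phi hD hZ y (V y)
    have s1 := hc.smooth_xi.smul (pV.inner hZ)
    have s2 := pV.smul (hc.smooth_eta hZ)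
    rw [e1, covDeriv_add D (hc.smooth_phi.apply dV) ((s1.sub s2).const_smul α),
      covDeriv_const_smul D α (s1.sub s2), covDeriv_sub D s1 s2,
      covDeriv_smul D (pV.inner hZ) hc.smooth_xi, covDeriv_smul D (hc.smooth_eta hZ) pV,
      h.covDeriv_phi hD dV, hm.deriv_inner pV hZ, hc.deriv_eta hm hZ, h.covDeriv_phi hD hV,
      h.covDeriv_xi hD]
  simp only [curvatureField]
  rw [e _ hY, e _ hX, h.covDeriv_phi hD hZ, hD.mlieBracket_eq hX hY]
  refine ext_inner_right ℝ fun w ↦ ?_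
  have hr : ∀ v w : T E x, inner ℝ (φ x v) w = -inner ℝ v (φ x w) := fun v w ↦ by
    rw [hc.skew, neg_neg]
  simp only [map_sub, inner_add_left, inner_sub_left, inner_smul_left, inner_sub_right,
    inner_smul_right, RCLike.conj_to_real, hc.inner_xi_left, hc.eta_eq, hr,
    real_inner_comm (X x) (Z x), real_inner_comm (Y x) (Z x)]
  ring


end IsAlphaCosymplectic

end Structure

/-! ### The quarter-symmetric metric connection -/

section QuarterSymmetric

variable [T2Space M] [RiemannianBundle (fun x : M ↦ T E x)]
  [IsContMDiffRiemannianBundle 𝓘(ℝ, E) ∞ E (fun x : M ↦ T E x)]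
  {X Y Z W : (x : M) → T E x} {D LC : Connection E M} {α : ℝ}
  {φ : (x : M) → T E x →L[ℝ] T E x} {ξ : (x : M) → T E x} {η : (x : M) → T E x →L[ℝ] ℝ}

/-- The quarter-symmetric metric connection is `D_X Y = ∇_X Y - η(X) φ Y`. The difference of the two
sides is symmetric in `X` and `Y` by the torsion condition and skew-symmetric in `Y` because both
connections are metric. -/
lemma IsQuarterSymmetricMetric.covDeriv_eq (h : IsQuarterSymmetricMetric φ η D)
    (hc : IsAlmostContactMetric φ ξ η) (hLC : IsLeviCivita LC) (hY : IsSmoothField Y) (x : M)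
    (u : T E x) : D Y x u = LC Y x u - η x u • φ x (Y x) := by
  let a : ((x : M) → T E x) → ((x : M) → T E x) → ((x : M) → T E x) → ℝ := fun A B C ↦
    inner ℝ (D B x (A x) - LC B x (A x) + η x (A x) • φ x (B x)) (C x)
  have hsymm : ∀ {A B C}, IsSmoothField A → IsSmoothField B → IsSmoothField C →
      a A B C = a B A C := fun {A B C} hA hB hC ↦ by
    have t := D.torsion_apply (hA.mdiffAt x) (hB.mdiffAt x)
    rw [h.torsion_eq, hLC.mlieBracket_eq hA hB] at t
    have t' := congrArg (fun v ↦ inner ℝ v (C x)) t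
    simp only [a, inner_sub_left, inner_add_left] at t' ⊢
    linarith
  have hskew : ∀ {A B C}, IsSmoothField A → IsSmoothField B → IsSmoothField C →
      a A B C = -a A C B := fun {A B C} hA hB hC ↦ by
    have e := (h.metric.deriv_inner hB hC x (A x)).symm.trans
      (hLC.metric.deriv_inner hB hC x (A x))
    have s : inner ℝ (φ x (B x)) (C x) = -inner ℝ (φ x (C x)) (B x) := by
      rw [← hc.skew, real_inner_comm]
    rw [real_inner_comm (D C x (A x)), real_inner_comm (LC C x (A x))] at e
    simp only [a, inner_sub_left, inner_add_left, inner_smul_left, RCLike.conj_to_real]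
    rw [s]
    linarith
  obtain ⟨X, hX, rfl⟩ := exists_smooth_field x u
  rw [← sub_eq_zero]
  refine ext_inner_right ℝ fun w ↦ ?_
  obtain ⟨Z, hZ, rfl⟩ := exists_smooth_field x w
  have z : a X Y Z = 0 := by
    have h1 := hskew hX hY hZ
    have h2 := hsymm hX hZ hY
    have h3 := hskew hZ hX hY
    have h4 := hsymm hZ hY hX
    have h5 := hskew hY hZ hX
    have h6 := hsymm hY hX hZ
    linarith
  rw [inner_zero_left, ← z, ← sub_add]

/-- The curvature of the quarter-symmetric metric connection of an `α`-cosymplectic manifold. -/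
lemma IsQuarterSymmetricMetric.curvature_eq (h : IsQuarterSymmetricMetric φ η D)
    (hM : IsAlphaCosymplectic α φ ξ η) (hLC : IsLeviCivita LC) (x : M) (u v w : T E x) :
    curvature D x u v w = curvature LC x u v w
      + α • (η x u • (inner ℝ (φ x v) w • ξ x - η x w • φ x v)
        - η x v • (inner ℝ (φ x u) w • ξ x - η x w • φ x u)) := by
  have hc := hM.almostContact
  obtain ⟨X, hX, rfl⟩ := exists_smooth_field x u
  obtain ⟨Y, hY, rfl⟩ := exists_smooth_field x v
  obtain ⟨Z, hZ, rfl⟩ := exists_smooth_field x w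
  rw [StarEtaSoliton.curvature_eq h.smooth h.metric hX hY hZ,
    StarEtaSoliton.curvature_eq hLC.smooth hLC.metric hX hY hZ]
  have e : ∀ {V : (x : M) → T E x} (u : T E x), IsSmoothField V →
      D (fun y ↦ D Z y (V y)) x u = LC (fun y ↦ LC Z y (V y)) x u
        - (η x (V x) • (φ x (LC Z x u)
            + α • (inner ℝ (φ x u) (Z x) • ξ x - η x (Z x) • φ x u))
          + (η x (LC V x u) + inner ℝ (V x) (LC ξ x u)) • φ x (Z x))
        - η x u • (φ x (LC Z x (V x)) - η x (V x) • φ x (φ x (Z x))) := by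
    intro V u hV
    have pZ := hc.smooth_phi.apply hZ
    have dV := hV.covDeriv hLC.smooth hZ
    have s1 := pZ.smul (hc.smooth_eta hV)
    have e1 : (fun y ↦ D Z y (V y)) = (fun y ↦ LC Z y (V y))
        - (fun y ↦ η y (V y)) • fun y ↦ φ y (Z y) := by
      ext1 y
      exact h.covDeriv_eq hc hLC hZ y (V y)
    rw [e1, h.covDeriv_eq hc hLC (dV.sub s1), covDeriv_sub LC dV s1,
      covDeriv_smul LC (hc.smooth_eta hV) pZ, hc.deriv_eta hLC.metric hV,
      hM.covDeriv_phi hLC hZ]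
    simp only [Pi.sub_apply, Pi.smul_apply', map_sub, map_smul]
  have hs := hM.inner_covDeriv_xi_symm hLC x (X x) (Y x)
  rw [real_inner_comm, real_inner_comm (X x)] at hs
  simp only [curvatureField]
  rw [e _ hY, e _ hX, h.covDeriv_eq hc hLC hZ, hLC.mlieBracket_eq hX hY, hs]
  simp only [map_sub]
  module

end QuarterSymmetric

/-! ### Traces of curvature-like tensors -/

section Trace

variable {V : Type*} [NormedAddCommGroup V] [InnerProductSpace ℝ V] {ι : Type*} [Fintype ι]

/-- A skew-symmetric map can be moved between the arguments of a metric trace, with a sign. -/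
lemma sum_skew_left (e : OrthonormalBasis ι ℝ V) {φ : V →L[ℝ] V}
    (hφ : ∀ u v, inner ℝ u (φ v) = -inner ℝ (φ u) v) {B : V → V → ℝ}
    (hl : ∀ v, IsLinearMap ℝ (fun u ↦ B u v)) (hr : ∀ u, IsLinearMap ℝ (B u)) :
    ∑ i, B (φ (e i)) (e i) = -∑ i, B (e i) (φ (e i)) := by
  have h1 : ∀ i, B (φ (e i)) (e i) = ∑ k, inner ℝ (e k) (φ (e i)) * B (e k) (e i) := fun i ↦ by
    conv_lhs => rw [← e.sum_repr' (φ (e i))]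
    exact (map_sum ((hl (e i)).mk' _) _ _).trans
      (Finset.sum_congr rfl fun k _ ↦ (hl (e i)).map_smul _ _)
  have h2 : ∀ k, B (e k) (φ (e k)) = ∑ i, inner ℝ (e i) (φ (e k)) * B (e k) (e i) := fun k ↦ by
    conv_lhs => rw [← e.sum_repr' (φ (e k))]
    exact (map_sum ((hr (e k)).mk' _) _ _).trans
      (Finset.sum_congr rfl fun i _ ↦ (hr (e k)).map_smul _ _)
  simp only [h1, h2]
  rw [Finset.sum_comm, ← Finset.sum_neg_distrib]
  refine Finset.sum_congr rfl fun k _ ↦ ?_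
  rw [← Finset.sum_neg_distrib]
  refine Finset.sum_congr rfl fun i _ ↦ ?_
  rw [hφ, real_inner_comm, neg_mul]

/-- If an algebraic curvature tensor `K` commutes with `φ`, then its `∗`-scalar curvature equals its
scalar curvature, as on a Kähler manifold. -/
lemma star_trace_eq_of_commute (e : OrthonormalBasis ι ℝ V) {φ : V →L[ℝ] V} {ξ : V}
    (hsq : ∀ u, φ (φ u) = -u + inner ℝ u ξ • ξ) (hφ : ∀ u v, inner ℝ u (φ v) = -inner ℝ (φ u) v)
    (hφξ : φ ξ = 0) {K : V → V → V → V}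
    (hl : ∀ v w, IsLinearMap ℝ (fun u ↦ K u v w)) (hr : ∀ u v, IsLinearMap ℝ (K u v))
    (hanti : ∀ u v w, K u v w = -K v u w)
    (hskew : ∀ u v w z, inner ℝ (K u v w) z = -inner ℝ w (K u v z))
    (hB : ∀ u v w, K u v w + K v w u + K w u v = 0)
    (hcomm : ∀ u v w, K u v (φ w) = φ (K u v w)) :
    ∑ i, (1 / 2) * ∑ j, inner ℝ (φ (K (e i) (φ (e i)) (e j))) (e j)
      = ∑ j, ∑ i, inner ℝ (K (e i) (e j) (e j)) (e i) := by
  have hK : ∀ u v w, inner ℝ (K u v w) ξ = 0 := fun u v w ↦ by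
    have h0 : K u v (φ ξ) = 0 := by rw [hφξ]; exact (hr u v).map_zero
    have h1 := hsq (K u v ξ)
    have h2 : inner ℝ (K u v ξ) ξ = 0 := by
      have := hskew u v ξ ξ
      rw [real_inner_comm] at this ⊢
      linarith
    rw [← hcomm, h0, map_zero, h2, zero_smul, add_zero, zero_eq_neg] at h1
    rw [hskew, h1, inner_zero_right, neg_zero]
  have hiso : ∀ u v w z, inner ℝ (K u v (φ w)) (φ z) = inner ℝ (K u v w) z := fun u v w z ↦ by
    rw [hcomm, hφ, hsq, inner_add_left, inner_smul_left, hK]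
    simp
  have hs : ∀ u v w, inner ℝ (K u v w) v = inner ℝ (K v u v) w := fun u v w ↦ by
    rw [hskew, real_inner_comm, hanti u v, inner_neg_left, neg_neg]
  have h1 : ∀ i j, inner ℝ (φ (K (e i) (φ (e i)) (e j))) (e j)
      = inner ℝ (K (φ (e i)) (e j) (e i)) (φ (e j)) + inner ℝ (K (e j) (e i) (e i)) (e j) :=
    fun i j ↦ by
      rw [← hiso (e j) (e i) (e i), ← inner_add_left, ← neg_eq_iff_eq_neg.2 (hφ _ _)]
      have := hB (e i) (φ (e i)) (e j)
      rw [add_assoc, add_eq_zero_iff_eq_neg] at this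
      rw [this, inner_neg_left, neg_neg]
  have h2 : ∀ j, ∑ i, inner ℝ (K (φ (e i)) (e j) (e i)) (φ (e j))
      = ∑ i, inner ℝ (K (e i) (e j) (e j)) (e i) := fun j ↦ by
    rw [sum_skew_left e hφ (B := fun u v ↦ inner ℝ (K u (e j) v) (φ (e j))),
      ← Finset.sum_neg_distrib]
    · refine Finset.sum_congr rfl fun i _ ↦ ?_
      rw [hiso, hskew (e i) (e j) (e j), real_inner_comm]
    · intro v
      exact ⟨fun a b ↦ by rw [(hl _ _).map_add, inner_add_left],
        fun c a ↦ by rw [(hl _ _).map_smul, inner_smul_left]; rfl⟩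
    · intro v
      exact ⟨fun a b ↦ by rw [(hr _ _).map_add, inner_add_left],
        fun c a ↦ by rw [(hr _ _).map_smul, inner_smul_left]; rfl⟩
  simp only [h1, Finset.sum_add_distrib, ← Finset.mul_sum]
  rw [Finset.sum_comm, Finset.sum_congr rfl fun j _ ↦ h2 j]
  ring

end Trace

/-! ### Scalar curvatures and the Laplacian -/

section Scalar

variable [T2Space M] [RiemannianBundle (fun x : M ↦ T E x)]
  [IsContMDiffRiemannianBundle 𝓘(ℝ, E) ∞ E (fun x : M ↦ T E x)]
  {D LC : Connection E M} {α : ℝ}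
  {φ : (x : M) → T E x →L[ℝ] T E x} {ξ : (x : M) → T E x} {η : (x : M) → T E x →L[ℝ] ℝ}

lemma sum_frame_inner_self (x : M) :
    ∑ i, inner ℝ (frame (E := E) x i) (frame x i) = (Module.finrank ℝ E : ℝ) := by
  simp only [real_inner_self_eq_norm_sq, (frame x).norm_eq_one, one_pow, Finset.sum_const,
    Finset.card_univ, Fintype.card_fin, nsmul_eq_mul, mul_one]
  rfl

lemma sum_frame_mul (x : M) (u v : T E x) :
    ∑ i, inner ℝ u (frame x i) * inner ℝ v (frame x i) = inner ℝ u v := by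
  rw [← (frame x).sum_inner_mul_inner u v]
  simp only [real_inner_comm v]

lemma IsAlmostContactMetric.inner_phi_self (hc : IsAlmostContactMetric φ ξ η) (x : M)
    (u : T E x) : inner ℝ (φ x u) u = 0 := by
  have := hc.skew x u u
  rw [real_inner_comm] at this
  linarith

lemma IsAlmostContactMetric.sum_eta_sq (hc : IsAlmostContactMetric φ ξ η) (x : M) :
    ∑ i, η x (frame x i) * η x (frame x i) = 1 := by
  simpa only [hc.norm_xi, hc.inner_xi_left] using sum_frame_mul x (ξ x) (ξ x)

/-- For the Levi-Civita connection of an `α`-cosymplectic manifold, `r* = r + α² (n - 1)²`: compare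
the two traces of the tensor `R(u,v) w + α² (g(v,w) u - g(u,w) v)`, which commutes with `φ`. -/
lemma IsAlphaCosymplectic.starScalarCurv_eq (hM : IsAlphaCosymplectic α φ ξ η)
    (hLC : IsLeviCivita LC) (x : M) :
    starScalarCurv LC φ x
      = scalarCurv LC x + α ^ 2 * ((Module.finrank ℝ E : ℝ) - 1) ^ 2 := by
  have hc := hM.almostContact
  have hs := hLC.smooth
  have hm := hLC.metric
  have key := star_trace_eq_of_commute (frame x) (φ := φ x) (ξ := ξ x)
    (K := fun u v w ↦ curvature LC x u v w + α ^ 2 • (inner ℝ v w • u - inner ℝ u w • v))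
    (fun u ↦ by rw [hc.phi_sq, hc.eta_eq]) (hc.skew x) (hc.phi_xi x)
    (fun v w ↦ ⟨fun a b ↦ by
        rw [(curvature_isLinearMap_left hs hm x v w).map_add, inner_add_left]; module,
      fun c a ↦ by
        rw [(curvature_isLinearMap_left hs hm x v w).map_smul, real_inner_smul_left]; module⟩)
    (fun u v ↦ ⟨fun a b ↦ by
        rw [(curvature_isLinearMap_right hs hm x u v).map_add, inner_add_right, inner_add_right]
        module,
      fun c a ↦ by
        rw [(curvature_isLinearMap_right hs hm x u v).map_smul, real_inner_smul_right,
          real_inner_smul_right]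
        module⟩)
    (fun u v w ↦ by rw [curvature_antisymm]; module)
    (fun u v w z ↦ by
      simp only [inner_add_left, inner_add_right, inner_sub_left, inner_sub_right,
        real_inner_smul_left, real_inner_smul_right, inner_curvature hs hm x u v w z]
      rw [real_inner_comm u w, real_inner_comm v w]
      ring)
    (fun u v w ↦ by
      rw [← hLC.bianchi x u v w, real_inner_comm u w, real_inner_comm u v, real_inner_comm v w]
      module)
    (fun u v w ↦ by
      rw [hM.curvature_phi hLC]
      simp only [map_add, map_sub, map_smul]
      module)
  have h1 : ∀ i, (1 / 2 : ℝ) * ∑ j, inner ℝ (φ x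
        (curvature LC x (frame x i) (φ x (frame x i)) (frame x j)
        + α ^ 2 • (inner ℝ (φ x (frame x i)) (frame x j) • frame x i
          - inner ℝ (frame x i) (frame x j) • φ x (frame x i)))) (frame x j)
      = (1 / 2) * ∑ j, inner ℝ (φ x (curvature LC x (frame x i) (φ x (frame x i)) (frame x j)))
          (frame x j) + α ^ 2 * (1 - η x (frame x i) * η x (frame x i)) := fun i ↦ by
    simp only [map_add, map_smul, map_sub, inner_add_left, inner_sub_left, real_inner_smul_left,
      Finset.sum_add_distrib, Finset.sum_sub_distrib, ← Finset.mul_sum, sum_frame_mul]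
    have n1 : inner ℝ (frame x i) (frame x i) = (1 : ℝ) := by
      rw [real_inner_self_eq_norm_sq, (frame x).norm_eq_one, one_pow]
    have n2 : inner ℝ (frame x i) (φ x (φ x (frame x i)))
        = -(1 - η x (frame x i) * η x (frame x i)) := by
      rw [hc.skew, hc.compatible, n1]
    rw [hc.compatible, n1, n2]
    ring
  have h2 : ∀ j, ∑ i, inner ℝ (curvature LC x (frame x i) (frame x j) (frame x j)
        + α ^ 2 • (inner ℝ (frame x j) (frame x j) • frame x i
          - inner ℝ (frame x i) (frame x j) • frame x j)) (frame x i)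
      = ∑ i, inner ℝ (curvature LC x (frame x i) (frame x j) (frame x j)) (frame x i)
        + α ^ 2 * ((Module.finrank ℝ E : ℝ) - 1) := fun j ↦ by
    have n1 : inner ℝ (frame x j) (frame x j) = (1 : ℝ) := by
      rw [real_inner_self_eq_norm_sq, (frame x).norm_eq_one, one_pow]
    simp only [inner_add_left, inner_sub_left, real_inner_smul_left,
      Finset.sum_add_distrib, Finset.sum_sub_distrib, ← Finset.mul_sum, sum_frame_inner_self,
      n1, one_mul, real_inner_comm (frame x j), sum_frame_mul]
  -- trace of the constant parts: `α² (n - 1)` on the left, `n α² (n - 1)` on the right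
  have hn : (∑ _i : Fin (Module.finrank ℝ (T E x)), (1 : ℝ)) = Module.finrank ℝ E := by
    simp only [Finset.sum_const, Finset.card_univ, Fintype.card_fin, nsmul_eq_mul, mul_one]
    rfl
  have hk : ∀ c : ℝ, (∑ _i : Fin (Module.finrank ℝ (T E x)), c) = Module.finrank ℝ E * c :=
    fun c ↦ by rw [← hn, Finset.sum_mul, one_mul]
  rw [Finset.sum_congr rfl fun i _ ↦ h1 i, Finset.sum_congr rfl fun j _ ↦ h2 j,
    Finset.sum_add_distrib, Finset.sum_add_distrib, ← Finset.mul_sum, ← Finset.mul_sum,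
    Finset.sum_sub_distrib, hn, hc.sum_eta_sq, hk] at key
  simp only [starScalarCurv, scalarCurv, traceForm, starRicci, ricci, traceEndo, ← Finset.mul_sum]
  linarith

/-- The quarter-symmetric metric connection has the scalar curvature of the metric: the correction
to the curvature is traceless because `φ` is skew-symmetric. -/
lemma IsQuarterSymmetricMetric.scalarCurv_eq (h : IsQuarterSymmetricMetric φ η D)
    (hM : IsAlphaCosymplectic α φ ξ η) (hLC : IsLeviCivita LC) (x : M) :
    scalarCurv D x = scalarCurv LC x := by
  have hc := hM.almostContact
  simp only [scalarCurv, traceForm, ricci, traceEndo]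
  refine Finset.sum_congr rfl fun j _ ↦ Finset.sum_congr rfl fun i _ ↦ ?_
  have s : inner ℝ (φ x (frame x j)) (frame x i) = -inner ℝ (φ x (frame x i)) (frame x j) := by
    rw [← hc.skew, real_inner_comm]
  simp only [h.curvature_eq hM hLC, inner_add_left, inner_sub_left, real_inner_smul_left,
    hc.inner_phi_self, hc.inner_xi_left, s]
  ring

/-- The quarter-symmetric metric connection has the `∗`-scalar curvature of the metric. -/
lemma IsQuarterSymmetricMetric.starScalarCurv_eq (h : IsQuarterSymmetricMetric φ η D)
    (hM : IsAlphaCosymplectic α φ ξ η) (hLC : IsLeviCivita LC) (x : M) :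
    starScalarCurv D φ x = starScalarCurv LC φ x := by
  have hc := hM.almostContact
  simp only [starScalarCurv, traceForm, starRicci, traceEndo]
  refine Finset.sum_congr rfl fun i _ ↦ ?_
  have z : ∑ j, η x (frame x j) * inner ℝ (φ x (frame x i)) (frame x j) = 0 := by
    have := sum_frame_mul x (ξ x) (φ x (frame x i))
    simpa only [hc.inner_xi_left, hc.eta_phi] using this
  have e : ∀ j, inner ℝ (φ x (curvature D x (frame x i) (φ x (frame x i)) (frame x j))) (frame x j)
      = inner ℝ (φ x (curvature LC x (frame x i) (φ x (frame x i)) (frame x j))) (frame x j)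
        + α * η x (frame x i)
          * (η x (frame x j) * inner ℝ (φ x (frame x i)) (frame x j)) := fun j ↦ by
    simp only [h.curvature_eq hM hLC, hc.eta_phi, hc.phi_sq, hc.phi_xi, map_add, map_sub, map_smul,
      map_neg, smul_zero, zero_smul, sub_zero, zero_sub, add_zero, inner_add_left,
      inner_neg_left, real_inner_smul_left]
    ring
  simp only [e, Finset.sum_add_distrib, ← Finset.mul_sum, z]
  ring

lemma IsQuarterSymmetricMetric.covDeriv_xi (h : IsQuarterSymmetricMetric φ η D)
    (hc : IsAlmostContactMetric φ ξ η) (hLC : IsLeviCivita LC) (x : M) (u : T E x) :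
    D ξ x u = LC ξ x u := by
  rw [h.covDeriv_eq hc hLC hc.smooth_xi, hc.phi_xi, smul_zero, sub_zero]

lemma IsQuarterSymmetricMetric.sum_lieMetric (h : IsQuarterSymmetricMetric φ η D)
    (hc : IsAlmostContactMetric φ ξ η) (hLC : IsLeviCivita LC) (x : M) :
    ∑ i, lieMetric D ξ x (frame x i) (frame x i) = 2 * divergence LC ξ x := by
  simp only [divergence, traceEndo, lieMetric, Finset.mul_sum, h.covDeriv_xi hc hLC]
  refine Finset.sum_congr rfl fun i _ ↦ ?_
  rw [real_inner_comm]
  ring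

/-- The metric trace of the soliton equation in its `∗`-Ricci form. -/
lemma IsStarEtaEinsteinSoliton.trace_eq {Λ μ : ℝ} (hsol : IsStarEtaEinsteinSoliton D φ ξ η Λ μ)
    (hD : IsQuarterSymmetricMetric φ η D) (hc : IsAlmostContactMetric φ ξ η)
    (hLC : IsLeviCivita LC) (x : M) :
    2 * divergence LC ξ x + 2 * starScalarCurv D φ x
      + (Module.finrank ℝ E : ℝ) * (2 * Λ + starScalarCurv D φ x) + 2 * μ = 0 := by
  have t : ∑ i, _ = ∑ i, (0 : ℝ) :=
    Finset.sum_congr rfl fun i _ ↦ hsol x (frame x i) (frame x i)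
  simp only [Finset.sum_add_distrib, ← Finset.mul_sum, hD.sum_lieMetric hc hLC,
    sum_frame_inner_self, hc.sum_eta_sq, Finset.sum_const_zero] at t
  rw [show ∑ i, starRicci D φ x (frame x i) (frame x i) = starScalarCurv D φ x from rfl] at t
  linarith

/-- The metric trace of the soliton equation in its Ricci form. -/
lemma IsReducedStarEtaEinsteinSoliton.trace_eq {Λ μ : ℝ}
    (hsol : IsReducedStarEtaEinsteinSoliton α D ξ η Λ μ)
    (hD : IsQuarterSymmetricMetric φ η D) (hc : IsAlmostContactMetric φ ξ η)
    (hLC : IsLeviCivita LC) (x : M) :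
    2 * divergence LC ξ x + 2 * scalarCurv D x
      + (Module.finrank ℝ E : ℝ) * (2 * Λ + 2 * α ^ 2 * ((Module.finrank ℝ E : ℝ) - 2)
        + scalarCurv D x + α ^ 2 * ((Module.finrank ℝ E : ℝ) - 1) ^ 2)
      + (2 * μ + 2 * α ^ 2) = 0 := by
  have t : ∑ i, _ = ∑ i, (0 : ℝ) :=
    Finset.sum_congr rfl fun i _ ↦ hsol x (frame x i) (frame x i)
  simp only [Finset.sum_add_distrib, ← Finset.mul_sum, hD.sum_lieMetric hc hLC,
    sum_frame_inner_self, hc.sum_eta_sq, Finset.sum_const_zero] at t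
  rw [show ∑ i, ricci D x (frame x i) (frame x i) = scalarCurv D x from rfl] at t
  linarith

end Scalar

end StarEtaSoliton

theorem theorem5p3 (n : ℕ) {M : Type*} [TopologicalSpace M] [T2Space M]
    [SecondCountableTopology M] [ConnectedSpace M]
    [ChartedSpace (EuclideanSpace ℝ (Fin n)) M] [IsManifold (𝓡 n) ∞ M]
    [RiemannianBundle (fun x : M ↦ TangentSpace (𝓡 n) x)]
    [IsContMDiffRiemannianBundle (𝓡 n) ∞ (EuclideanSpace ℝ (Fin n))
      (fun x : M ↦ TangentSpace (𝓡 n) x)]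
    (α Λ μ : ℝ)
    (φ : (x : M) → TangentSpace (𝓡 n) x →L[ℝ] TangentSpace (𝓡 n) x)
    (ξ : (x : M) → TangentSpace (𝓡 n) x)
    (η : (x : M) → TangentSpace (𝓡 n) x →L[ℝ] ℝ)
    (hM : StarEtaSoliton.IsAlphaCosymplectic α φ ξ η)
    (LC : StarEtaSoliton.Connection (EuclideanSpace ℝ (Fin n)) M)
    (hLC : StarEtaSoliton.IsLeviCivita LC)
    (D : StarEtaSoliton.Connection (EuclideanSpace ℝ (Fin n)) M)
    (hD : StarEtaSoliton.IsQuarterSymmetricMetric φ η D)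
    (hsol : StarEtaSoliton.IsStarEtaEinsteinSoliton D φ ξ η Λ μ ∨
      StarEtaSoliton.IsReducedStarEtaEinsteinSoliton α D ξ η Λ μ)
    (f : M → ℝ) (hf : ContMDiff (𝓡 n) 𝓘(ℝ, ℝ) ∞ f)
    (hgrad : ∀ x, ξ x = StarEtaSoliton.grad f x) (x : M) :
    StarEtaSoliton.laplacian LC f x =
      -(n : ℝ) * (Λ + α ^ 2 * ((n : ℝ) - 2) + StarEtaSoliton.scalarCurv LC x / 2
          + α ^ 2 * ((n : ℝ) - 1) ^ 2 / 2)
        - μ - (α ^ 2 + StarEtaSoliton.scalarCurv LC x) := by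
  have hc := hM.almostContact
  have hξ : (fun y ↦ StarEtaSoliton.grad f y) = ξ := funext fun y ↦ (hgrad y).symm
  rw [StarEtaSoliton.laplacian, hξ]
  have hr := hD.scalarCurv_eq hM hLC x
  have hr' := (hD.starScalarCurv_eq hM hLC x).trans (hM.starScalarCurv_eq hLC x)
  rcases hsol with hsol | hsol
  · have t := hsol.trace_eq hD hc hLC x
    rw [hr'] at t
    simp only [finrank_euclideanSpace_fin] at t
    linarith
  · have t := hsol.trace_eq hD hc hLC x
    rw [hr] at t
    simp only [finrank_euclideanSpace_fin] at t
    linarith
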